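/- For a finite graph $G$ let $X_G=\sum_\kappa\prod_{v\in V(G)}x_{\kappa(v)}$ be its chromatic symmetric function, where $\kappa$ runs over the proper colorings of $G$ with colors $1,2,\dots$. For a composition $I=i_1i_2\cdots i_s\vDash n$ (a sequence of positive integers with sum $n$) let $e_I=e_{i_1}e_{i_2}\cdots e_{i_s}$ be the product of elementary symmetric functions, let $w_I=i_1\prod_{j\ge2}(i_j-1)$, and for $0\le a\le n$ let $$\Theta_I^+(a)=\min\{i_1+\dots+i_k : 0\le k\le s,\ i_1+\dots+i_k\ge a\}-a .$$ For $m\ge2$ and $l\ge 1$ let the tadpole $T_{m,l}$ be the graph with $m+l$ vertices and $m+l$ edges obtained from the disjoint union of the cycle $C_m$ and the path $P_l$ on $l$ vertices by joining a vertex of $C_m$ to an end of $P_l$ by an edge; here $C_2$ consists of two vertices joined by two parallel edges. Let $\mathcal L(T_{m,l})$ be its line graph, whose vertices are the edges of $T_{m,l}$, two distinct ones being adjacent if they have a common end. Then for all integers $n,l$ with $1\le l\le n-2$, $$X_{\mathcal L(T_{n-l,\,l})}=\sum_{I\vDash n,\ \Theta_I^+(l)=0}\bigl(\Theta_I^+(l+1)-1\bigr)w_Ie_I+2\sum_{I\vDash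 n,\ \Theta_I^+(l)\ge2}\Theta_I^+(l+1)\,w_Ie_I .$$ Moreover, this is a positive $e_I$-expansion: $(\Theta_I^+(l+1)-1)w_I\ge0$ for every $I\vDash n$ with $\Theta_I^+(l)=0$, and $\Theta_I^+(l+1)w_I\ge0$ for every $I\vDash n$ with $\Theta_I^+(l)\ge2$. -/

import Mathlib

noncomputable section

/-- The chromatic symmetric function `X_G = ∑_κ ∏_v x_{κ(v)}` of a finite simple graph `G`, as a
formal power series in the countably many variables `x_0, x_1, …`; here `κ` runs over the proper
colorings of `G`. The coefficient of `x^d` is the number of proper colorings that use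
each color `i` exactly `d i` times. -/
def chromaticSymm {V : Type*} [Finite V] (G : SimpleGraph V) : MvPowerSeries ℕ ℚ :=
  fun d ↦ (Nat.card {κ : G.Coloring ℕ // ∀ i, Nat.card {v : V // κ v = i} = d i} : ℚ)

/-- The elementary symmetric function `e_k`: the sum of all squarefree monomials of
degree `k`. -/
def elemSymm (k : ℕ) : MvPowerSeries ℕ ℚ :=
  open Classical in
  fun d ↦ if (∀ i, d i ≤ 1) ∧ d.degree = k then 1 else 0

/-- The function `e_I = e_{i_1} e_{i_2} ⋯` for a composition `I = i_1 i_2 ⋯`. -/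
def elemSymmComp {n : ℕ} (I : Composition n) : MvPowerSeries ℕ ℚ :=
  (I.blocks.map elemSymm).prod

/-- The product `a_1 (a_2 - 1) (a_3 - 1) ⋯` for a list `a_1, a_2, …` (and `1` for the empty list). -/
def listWeight : List ℕ → ℤ
  | [] => 1
  | a :: t => (a : ℤ) * (t.map fun b : ℕ ↦ (b : ℤ) - 1).prod

/-- The weight `w_I = i_1 (i_2 - 1) (i_3 - 1) ⋯` of a composition `I = i_1 i_2 ⋯`. -/
def compWeight {n : ℕ} (I : Composition n) : ℤ := listWeight I.blocks

/-- The surplus partial sum `σ_I^+(a)`: the least partial sum `i_1 + ⋯ + i_k`, `0 ≤ k ≤ ℓ(I)`,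
that is at least `a`. It is meaningful for `a ≤ |I|`. -/
def surplusSum {n : ℕ} (I : Composition n) (a : ℕ) : ℕ :=
  sInf {s : ℕ | (∃ k ≤ I.length, I.sizeUpTo k = s) ∧ a ≤ s}

/-- The `a`-surplus `Θ_I^+(a) = σ_I^+(a) - a`. -/
def surplus {n : ℕ} (I : Composition n) (a : ℕ) : ℤ := (surplusSum I a : ℤ) - a

/-- The line graph of a multigraph: its vertices are the edges of `G`, and two distinct edges are
adjacent if they have a common end. -/
def multiLineGraph {α β : Type*} (G : Graph α β) : SimpleGraph G.edgeSet where
  Adj e f := e ≠ f ∧ ∃ v, G.Inc e v ∧ G.Inc f v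
  symm := ⟨fun _ _ h ↦ ⟨h.1.symm, h.2.imp fun _ hv ↦ hv.symm⟩⟩
  loopless := ⟨fun _ h ↦ h.1 rfl⟩

/-- The ends of the edge `e` of the tadpole whose cycle has the vertices `0, …, m - 1`, and whose
path has the vertices `m, m + 1, …`. The edges `0, …, m - 1` form the cycle, the edge `m` joins
the cycle vertex `m - 1` to the first vertex of the path, and the later edges form the path. -/
def tadpoleEnds (m e : ℕ) : Sym2 ℕ :=
  if e < m then s(e, (e + 1) % m) else s(e - 1, e)

/-- The tadpole `T_{m,l}`, obtained by joining a vertex of the cycle `C_m` to an end of the path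
`P_l` by an edge. It has `m + l` vertices and `m + l` edges; for `m = 2` the cycle `C_2`
consists of two parallel edges. -/
def tadpole (m l : ℕ) : Graph ℕ ℕ where
  vertexSet := Set.Iio (m + l)
  edgeSet := Set.Iio (m + l)
  IsLink e x y := e < m + l ∧ tadpoleEnds m e = s(x, y)
  isLink_symm _ _ := ⟨fun _ _ h ↦ ⟨h.1, h.2.trans Sym2.eq_swap⟩⟩
  eq_or_eq_of_isLink_of_isLink e x y v w h h' := by
    have h2 := h.2.symm.trans h'.2
    rw [Sym2.eq_iff] at h2
    tauto
  edge_mem_iff_exists_isLink e := by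
    refine ⟨fun h ↦ ?_, fun ⟨_, _, h⟩ ↦ h.1⟩
    induction hz : tadpoleEnds m e with
    | _ x y => exact ⟨x, y, h, rfl⟩
  left_mem_of_isLink e x y h := by
    obtain ⟨h1, h2⟩ := h
    have hx : x ∈ tadpoleEnds m e := h2 ▸ Sym2.mem_mk_left x y
    unfold tadpoleEnds at hx
    split_ifs at hx with hm
    · rcases Sym2.mem_iff.1 hx with rfl | rfl
      · exact h1
      · exact (Nat.mod_lt _ (by omega)).trans_le (Nat.le_add_right m l)
    · rcases Sym2.mem_iff.1 hx with rfl | rfl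
      · exact (Nat.sub_le e 1).trans_lt h1
      · exact h1

instance tadpole_finite_edgeSet (m l : ℕ) : Finite (tadpole m l).edgeSet :=
  (Set.finite_Iio (m + l)).to_subtype

end

/-! In finitely many variables let P_n and C_n be the coloring sums of the path and the cycle with n
vertices, and let M_{m,l} be the sum over pairs of colorings in which the path starts with the color
of a fixed cycle vertex. In the line graph of the tadpole, the first path edge is adjacent to two
consecutive vertices of an m-cycle. Their colors differ, so the two forbidden events are disjoint
and the coloring sum is C_m P_l - 2 M_{m,l} (`colorSum_lineGraph_tadpole`). This equals 2T - P_l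
C_m, where T = C_m P_l - M_{m,l} is the coloring sum of the tadpole itself.

Put E = ∑ e_k t^k and D = E - tE' = 1 - ∑_{k≥1} (k-1) e_k t^k. The recursions for colorings give ∑
P_n t^n = E/D and ∑_{n≥1} C_n t^n = -tD'/D. Expanding 1/D as a geometric series turns both into sums
over compositions (`pathSum_eq`, `cycleSum_eq`), and concatenation of compositions handles P_l C_m
(`pathSum_mul_cycleSum`). The recursion `mergeSum_succ` moves one vertex from the path to the cycle
and yields T by induction (`tadpole_sum_eq`); combining the two expansions gives `lineGraph_sum_eq`.

The passage to infinitely many variables compares coefficients at monomials in the first N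
variables, for every N. For positivity, the factor Θ(l+1) - 1 is negative only if the block after
the partial sum l is 1; that block is not the first one, so w_I = 0. -/

noncomputable section

/-! ### Recursions for colorings of paths and cycles. -/

section Algebra

variable {R ι : Type*} [CommRing R] [Fintype ι] (x : ι → R)

/-- The weight sum of the proper colorings of the path with `n` vertices whose first vertex has
the color `c`. -/
def headPath : ℕ → ι → R
  | 0, _ => 0
  | n + 1, c => x c * ((if n = 0 then 1 else 0) + ∑ b, headPath n b - headPath n c)

/-- The weight sum of the proper colorings of the path with `n` vertices. -/
def pathSum (n : ℕ) : R := (if n = 0 then 1 else 0) + ∑ c, headPath x n c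

/-- The weight sum of the proper colorings of the cycle with `n ≥ 1` vertices in which a fixed
vertex has the color `c`. -/
def rootedCycle : ℕ → ι → R
  -- The recursion is deletion-contraction at the closing edge. The value 1 at n = 0 makes the
  -- one-vertex cycle, a loop, contribute 0.
  | 0, _ => 1
  | n + 1, c => headPath x (n + 1) c - x c * rootedCycle n c

/-- The weight sum of the proper colorings of the cycle with `n ≥ 1` vertices. -/
def cycleSum (n : ℕ) : R := ∑ c, rootedCycle x n c

/-- The weight sum of the proper colorings of the disjoint union of the cycle with `m` vertices
and the path with `l` vertices in which the first vertex of the path has the color of a fixed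
vertex of the cycle. -/
def mergeSum (m l : ℕ) : R := ∑ c, rootedCycle x m c * headPath x l c

theorem headPath_succ (n : ℕ) (c : ι) :
    headPath x (n + 1) c = x c * (pathSum x n - headPath x n c) := rfl

theorem rootedCycle_succ (n : ℕ) (c : ι) :
    rootedCycle x (n + 1) c = headPath x (n + 1) c - x c * rootedCycle x n c := rfl

@[simp]
theorem headPath_zero (c : ι) : headPath x 0 c = 0 := by rw [headPath]

@[simp]
theorem rootedCycle_zero (c : ι) : rootedCycle x 0 c = 1 := by rw [rootedCycle]

@[simp]
theorem pathSum_zero : pathSum x 0 = 1 := by simp [pathSum]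

theorem pathSum_succ (n : ℕ) : pathSum x (n + 1) = ∑ c, headPath x (n + 1) c := by
  simp [pathSum]

theorem mul_headPath (n : ℕ) (c : ι) :
    x c * headPath x n c = x c * pathSum x n - headPath x (n + 1) c := by
  rw [headPath_succ]; ring

theorem sum_mul_headPath (n : ℕ) :
    ∑ c, x c * headPath x n c = (∑ c, x c) * pathSum x n - pathSum x (n + 1) := by
  simp only [mul_headPath, Finset.sum_sub_distrib, Finset.sum_mul, pathSum_succ]

/-- Joining the first vertices of two paths by an edge gives a path with a + b vertices, so the
pairs with equal first colors are all pairs minus the colorings of the long path. -/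
theorem sum_headPath_mul_headPath (a b : ℕ) :
    ∑ c, headPath x a c * headPath x b c
      = pathSum x a * pathSum x b - pathSum x (a + b) := by
  induction a generalizing b with
  | zero => simp
  | succ a ih =>
    have h : ∀ c, headPath x (a + 1) c * headPath x b c
        = pathSum x a * (x c * headPath x b c) - pathSum x b * (x c * headPath x a c)
          + headPath x a c * headPath x (b + 1) c := fun c ↦ by
      rw [headPath_succ x a, headPath_succ x b]; ring
    simp only [h, Finset.sum_add_distrib, Finset.sum_sub_distrib, ← Finset.mul_sum, ih,
      sum_mul_headPath]
    rw [show a + 1 + b = a + (b + 1) by ring]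
    ring

/-- A factor x_c is split off the path and absorbed by the rooted cycle through its own recursion;
the remaining products of two paths are evaluated by `sum_headPath_mul_headPath`. -/
theorem mergeSum_succ (m l : ℕ) :
    mergeSum x m (l + 1)
      = pathSum x (m + 1 + l) - cycleSum x (m + 1) * pathSum x l + mergeSum x (m + 1) l := by
  have h : ∀ c, rootedCycle x m c * headPath x (l + 1) c
      = headPath x (m + 1) c * pathSum x l - rootedCycle x (m + 1) c * pathSum x l
        - headPath x (m + 1) c * headPath x l c + rootedCycle x (m + 1) c * headPath x l c :=
    fun c ↦ by
      rw [rootedCycle_succ, headPath_succ x l]; ring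
  simp only [mergeSum, cycleSum, h, Finset.sum_add_distrib, Finset.sum_sub_distrib,
    ← Finset.sum_mul, sum_headPath_mul_headPath]
  rw [← pathSum_succ]
  ring

/-! ### Generating functions of paths and cycles. -/

open PowerSeries

/-- The generating function `∏ (1 + x_c t)` of the elementary symmetric functions. -/
def esymmSeries : R⟦X⟧ := ∏ c, (1 + C (x c) * X)

/-- The elementary symmetric function of degree `n` in finitely many variables. -/
def finEsymm (n : ℕ) : R := coeff n (esymmSeries x)

/-- The derivation `t d/dt`. -/
def euler (f : R⟦X⟧) : R⟦X⟧ := X * d⁄dX R f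

theorem coeff_euler (f : R⟦X⟧) (n : ℕ) : coeff n (euler f) = n * coeff n f := by
  cases n with
  | zero => simp [euler]
  | succ n => rw [euler, coeff_succ_X_mul, coeff_derivative]; push_cast; ring

theorem euler_mul (f g : R⟦X⟧) : euler (f * g) = euler f * g + f * euler g := by
  simp only [euler, Derivation.leibniz, smul_eq_mul]; ring

theorem headPath_series (c : ι) :
    mk (fun n ↦ headPath x n c) * (1 + C (x c) * X) = C (x c) * X * mk (pathSum x) := by
  ext n
  cases n with
  | zero => simp
  | succ n =>
    rw [mul_add, mul_one, map_add, coeff_mk,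
      show mk (fun n ↦ headPath x n c) * (C (x c) * X)
        = C (x c) * (mk (fun n ↦ headPath x n c)) * X by ring, coeff_succ_mul_X,
      mul_assoc, coeff_C_mul, coeff_C_mul, coeff_succ_X_mul, coeff_mk, coeff_mk, headPath_succ]
    ring

theorem rootedCycle_series (c : ι) :
    (mk (fun n ↦ rootedCycle x n c) - 1) * (1 + C (x c) * X)
      = mk (fun n ↦ headPath x n c) - C (x c) * X := by
  have : mk (fun n ↦ rootedCycle x n c) * (1 + C (x c) * X)
      = 1 + mk (fun n ↦ headPath x n c) := by
    ext n
    cases n with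
    | zero => simp
    | succ n =>
      rw [mul_add, mul_one, map_add, coeff_mk,
        show mk (fun n ↦ rootedCycle x n c) * (C (x c) * X)
          = C (x c) * (mk (fun n ↦ rootedCycle x n c)) * X by ring, coeff_succ_mul_X,
        coeff_C_mul, map_add, coeff_one, coeff_mk, coeff_mk, rootedCycle_succ]
      simp
  rw [sub_mul, this]; ring

theorem pathSum_series : mk (pathSum x) = 1 + ∑ c, mk (fun n ↦ headPath x n c) := by
  ext n
  simp [pathSum, coeff_one]

theorem euler_esymmSeries [DecidableEq ι] :
    euler (esymmSeries x) = ∑ c, C (x c) * X * ∏ b ∈ Finset.univ.erase c, (1 + C (x b) * X) := by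
  have h : ∀ s : Finset ι, euler (∏ c ∈ s, (1 + C (x c) * X))
      = ∑ c ∈ s, C (x c) * X * ∏ b ∈ s.erase c, (1 + C (x b) * X) := by
    intro s
    induction s using Finset.induction_on with
    | empty => simp [euler]
    | insert a s ha ih =>
      rw [Finset.prod_insert ha, euler_mul, ih, Finset.sum_insert ha, Finset.erase_insert ha,
        Finset.mul_sum]
      congr 1
      · congr 1
        ext n
        rw [coeff_euler, map_add, coeff_C_mul, coeff_X, coeff_one]
        split_ifs with h1 h2 <;> simp_all
      · refine Finset.sum_congr rfl fun c hc ↦ ?_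
        have hca : a ≠ c := fun h ↦ ha (h ▸ hc)
        rw [Finset.erase_insert_of_ne hca, Finset.prod_insert (by simp [ha])]
        ring
  exact h _

/-- The generating function of the elementary symmetric functions weighted by `1 - k`. -/
def pathDenom : R⟦X⟧ := esymmSeries x - euler (esymmSeries x)

theorem coeff_pathDenom (n : ℕ) : coeff n (pathDenom x) = (1 - n) * finEsymm x n := by
  rw [pathDenom, map_sub, coeff_euler, finEsymm]; ring

/-- Multiplying `headPath_series` by the factors of E other than 1 + x_c t and summing over c gives
(P - 1)E = P·tE'. -/
theorem pathSum_mul_pathDenom : mk (pathSum x) * pathDenom x = esymmSeries x := by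
  classical
  have h : (∑ c, mk (fun n ↦ headPath x n c)) * esymmSeries x
      = mk (pathSum x) * euler (esymmSeries x) := by
    rw [euler_esymmSeries, Finset.sum_mul, Finset.mul_sum]
    refine Finset.sum_congr rfl fun c _ ↦ ?_
    rw [esymmSeries, ← Finset.mul_prod_erase _ _ (Finset.mem_univ c), ← mul_assoc,
      headPath_series]
    ring
  rw [pathDenom, mul_sub, ← h, pathSum_series]
  ring

theorem isUnit_pathSum_series : IsUnit (mk (pathSum x)) := by
  rw [isUnit_iff_constantCoeff, ← coeff_zero_eq_constantCoeff_apply]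
  simp

theorem isUnit_one_add_C_mul_X (a : R) : IsUnit (1 + C a * X : R⟦X⟧) := by
  rw [isUnit_iff_constantCoeff]
  simp

/-- The generating function of the cycles, with constant term `0`. -/
def cycleSeries : R⟦X⟧ := ∑ c, (mk (fun n ↦ rootedCycle x n c) - 1)

theorem coeff_cycleSeries_succ (n : ℕ) :
    coeff (n + 1) (cycleSeries x) = cycleSum x (n + 1) := by
  simp only [cycleSeries, cycleSum, map_sum, map_sub, coeff_mk, coeff_one, Nat.succ_ne_zero,
    if_false, sub_zero]

theorem pathSum_mul_cycleSeries :
    mk (pathSum x) * cycleSeries x = euler (mk (pathSum x)) - mk (pathSum x) + 1 := by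
  -- Applying t d/dt to `headPath_series` gives a second relation. After multiplication by the unit
  -- 1 + x_c t, the claim is a linear combination of the three relations. Its sum over c only
  -- involves P and tP'.
  have key : ∀ c, mk (pathSum x) * (mk (fun n ↦ rootedCycle x n c) - 1)
      = mk (pathSum x) * euler (mk (fun n ↦ headPath x n c))
        - mk (fun n ↦ headPath x n c) * (1 + euler (mk (pathSum x))) := by
    intro c
    have h1 := headPath_series x c
    have h2 := rootedCycle_series x c
    have hX : euler (C (x c) * X) = C (x c) * X := by
      ext n
      rw [coeff_euler, coeff_C_mul, coeff_X]
      split_ifs with h <;> simp [h]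
    have h1' : euler (1 + C (x c) * X) = C (x c) * X := by
      conv_rhs => rw [← hX]
      simp [euler]
    have h3 := congrArg euler h1
    rw [euler_mul, euler_mul, h1', hX] at h3
    refine (isUnit_one_add_C_mul_X (x c)).mul_right_cancel ?_
    generalize mk (pathSum x) = P at *
    generalize mk (fun n ↦ headPath x n c) = A at *
    generalize mk (fun n ↦ rootedCycle x n c) = K at *
    generalize euler P = dP at *
    generalize euler A = dA at *
    linear_combination P * h2 - P * h3 + (1 + dP + P) * h1
  have hs := pathSum_series x
  have hd : euler (mk (pathSum x)) = ∑ c, euler (mk (fun n ↦ headPath x n c)) := by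
    rw [hs]
    simp [euler, Finset.mul_sum]
  rw [cycleSeries, Finset.mul_sum, Finset.sum_congr rfl fun c _ ↦ key c, Finset.sum_sub_distrib,
    ← Finset.mul_sum, ← Finset.sum_mul, ← hd, eq_sub_of_add_eq' hs.symm]
  ring

/-- The cycle series is minus the logarithmic derivative of D: multiply by P and use PD = E together
with its derivative. -/
theorem cycleSeries_mul_pathDenom : cycleSeries x * pathDenom x = -euler (pathDenom x) := by
  refine (isUnit_pathSum_series x).mul_left_cancel ?_
  have h1 := pathSum_mul_cycleSeries x
  have h2 := pathSum_mul_pathDenom x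
  have h3 := congrArg euler h2
  rw [euler_mul] at h3
  have h4 : pathDenom x = esymmSeries x - euler (esymmSeries x) := rfl
  linear_combination pathDenom x * h1 + h3 - h2 + h4

end Algebra

/-! ### Compositions as lists, their partial sums and weights. -/

section Compositions

/-- The block lists of the compositions of `n`. -/
def compLists (n : ℕ) : Finset (List ℕ) := Finset.univ.image (Composition.blocks (n := n))

theorem mem_compLists {n : ℕ} {L : List ℕ} :
    L ∈ compLists n ↔ (∀ i ∈ L, 0 < i) ∧ L.sum = n := by
  simp only [compLists, Finset.mem_image, Finset.mem_univ, true_and]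
  constructor
  · rintro ⟨I, rfl⟩
    exact ⟨fun i hi ↦ I.blocks_pos hi, I.blocks_sum⟩
  · rintro ⟨h1, h2⟩
    exact ⟨⟨L, fun hi ↦ h1 _ hi, h2⟩, rfl⟩

theorem sum_composition_blocks {M : Type*} [AddCommMonoid M] (n : ℕ) (f : List ℕ → M) :
    ∑ I : Composition n, f I.blocks = ∑ L ∈ compLists n, f L := by
  rw [compLists, Finset.sum_image]
  exact fun I _ J _ h ↦ Composition.ext h

theorem compLists_zero : compLists 0 = {[]} := by
  ext L
  rw [mem_compLists, Finset.mem_singleton]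
  constructor
  · rintro ⟨h1, h2⟩
    cases L with
    | nil => rfl
    | cons a t =>
      have := h1 a (by simp)
      simp at h2
      omega
  · rintro rfl
    simp

theorem sum_compLists_succ {M : Type*} [AddCommMonoid M] (n : ℕ) (f : List ℕ → M) :
    ∑ L ∈ compLists (n + 1), f L
      = ∑ k ∈ Finset.range (n + 1), ∑ L ∈ compLists (n - k), f ((k + 1) :: L) := by
  rw [Finset.sum_sigma']
  symm
  refine Finset.sum_bij (fun p _ ↦ (p.1 + 1) :: p.2) ?_ ?_ ?_ ?_
  · rintro ⟨k, L⟩ h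
    simp only [Finset.mem_sigma, Finset.mem_range, mem_compLists] at h
    simp only [mem_compLists, List.mem_cons, List.sum_cons]
    refine ⟨?_, by omega⟩
    rintro i (rfl | hi)
    · omega
    · exact h.2.1 i hi
  · rintro ⟨k, L⟩ _ ⟨k', L'⟩ _ h
    simp only [List.cons.injEq, add_left_inj] at h
    obtain ⟨rfl, rfl⟩ := h
    rfl
  · intro L hL
    rw [mem_compLists] at hL
    cases L with
    | nil => simp at hL
    | cons a t =>
      have ha := hL.1 a (by simp)
      have hs := hL.2
      rw [List.sum_cons] at hs
      refine ⟨⟨a - 1, t⟩, ?_, ?_⟩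
      · simp only [Finset.mem_sigma, Finset.mem_range, mem_compLists]
        exact ⟨by omega, fun i hi ↦ hL.1 i (by simp [hi]), by omega⟩
      · simp only [List.cons.injEq, and_true]
        omega
  · intros
    rfl

/-- The least partial sum of a list that is at least `a`. -/
def listSurplusSum (L : List ℕ) (a : ℕ) : ℕ :=
  sInf {s : ℕ | (∃ k ≤ L.length, (L.take k).sum = s) ∧ a ≤ s}

theorem surplusSum_eq {n : ℕ} (I : Composition n) (a : ℕ) :
    surplusSum I a = listSurplusSum I.blocks a := rfl

/-- The bound on a makes the set of partial sums nonempty; otherwise `sInf` would return 0. -/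
theorem le_listSurplusSum {L : List ℕ} {a : ℕ} (h : a ≤ L.sum) : a ≤ listSurplusSum L a := by
  have hne : {s : ℕ | (∃ k ≤ L.length, (L.take k).sum = s) ∧ a ≤ s}.Nonempty :=
    ⟨L.sum, ⟨L.length, le_rfl, by simp⟩, h⟩
  exact (Nat.sInf_mem hne).2

theorem exists_append_of_listSurplusSum_eq {L : List ℕ} {a : ℕ} (h : a ≤ L.sum)
    (ha : listSurplusSum L a = a) : ∃ J K, L = J ++ K ∧ J.sum = a := by
  have hne : {s : ℕ | (∃ k ≤ L.length, (L.take k).sum = s) ∧ a ≤ s}.Nonempty :=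
    ⟨L.sum, ⟨L.length, le_rfl, by simp⟩, h⟩
  obtain ⟨⟨k, -, hk⟩, -⟩ := Nat.sInf_mem hne
  exact ⟨L.take k, L.drop k, (List.take_append_drop k L).symm, hk.trans ha⟩

theorem listSurplusSum_succ_of_ne {L : List ℕ} {a : ℕ} (ha : listSurplusSum L a ≠ a) :
    listSurplusSum L (a + 1) = listSurplusSum L a := by
  unfold listSurplusSum
  congr 1
  ext s
  simp only [Set.mem_ofPred_eq]
  refine and_congr_right fun hs ↦ ⟨fun h ↦ by omega, fun h ↦ ?_⟩
  rcases h.eq_or_lt with rfl | h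
  · have hle : listSurplusSum L a ≤ a := Nat.sInf_le ⟨hs, le_rfl⟩
    refine absurd (le_antisymm hle ?_) ha
    exact (Nat.sInf_mem (s := {s : ℕ | (∃ k ≤ L.length, (L.take k).sum = s) ∧ a ≤ s})
      ⟨a, hs, le_rfl⟩).2
  · exact h

theorem listSurplusSum_append (J K : List ℕ) : listSurplusSum (J ++ K) J.sum = J.sum := by
  refine le_antisymm (Nat.sInf_le ⟨⟨J.length, by simp, by simp⟩, le_rfl⟩) ?_
  exact le_listSurplusSum (by simp)

theorem listSurplusSum_append_cons (J K : List ℕ) {b : ℕ} (hb : 0 < b) :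
    listSurplusSum (J ++ b :: K) (J.sum + 1) = J.sum + b := by
  have hmem : J.sum + b ∈ {s : ℕ | (∃ k ≤ (J ++ b :: K).length,
      ((J ++ b :: K).take k).sum = s) ∧ J.sum + 1 ≤ s} := by
    refine ⟨⟨J.length + 1, by simp, ?_⟩, by omega⟩
    simp [List.take_append, List.take_of_length_le]
  refine le_antisymm (Nat.sInf_le hmem) ?_
  obtain ⟨⟨k, -, hk⟩, hk'⟩ := Nat.sInf_mem ⟨_, hmem⟩
  change J.sum + b ≤ sInf _
  rw [← hk] at hk' ⊢
  rw [List.take_append, List.sum_append] at hk' ⊢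
  -- A partial sum taken inside J is at most `J.sum`, so the minimizer must contain all of J and the
  -- block b.
  rcases hkJ : k - J.length with _ | j
  · rw [hkJ] at hk'
    have := (List.take_sublist k J).sum_le_sum (by simp)
    simp at hk'
    omega
  · rw [List.take_of_length_le (by omega)]
    simp

theorem listSurplusSum_cons_one (K : List ℕ) {b : ℕ} (hb : 0 < b) :
    listSurplusSum (b :: K) 1 = b := by
  simpa using listSurplusSum_append_cons [] K hb

variable {R : Type*} [CommRing R] (e : ℕ → R)

/-- The product of the terms `(k - 1) e_k` over the entries `k` of a list. -/
def tailTerm (L : List ℕ) : R := (L.map fun k : ℕ ↦ ((k : R) - 1) * e k).prod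

/-- The term `w_I e_I` of a list `I`. -/
def listTerm (L : List ℕ) : R := (listWeight L : R) * (L.map e).prod

theorem listTerm_cons (a : ℕ) (L : List ℕ) : listTerm e (a :: L) = a * e a * tailTerm e L := by
  have : (((L.map fun b : ℕ ↦ (b : ℤ) - 1).prod : ℤ) : R) * (L.map e).prod = tailTerm e L := by
    induction L with
    | nil => simp [tailTerm]
    | cons b L ih =>
      rw [tailTerm] at ih ⊢
      simp only [List.map_cons, List.prod_cons, ← ih]
      push_cast
      ring
  rw [listTerm, listWeight, ← this]
  simp only [List.map_cons, List.prod_cons]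
  push_cast
  ring

theorem listTerm_append {J : List ℕ} (hJ : J ≠ []) (K : List ℕ) :
    listTerm e (J ++ K) = listTerm e J * tailTerm e K := by
  cases J with
  | nil => exact absurd rfl hJ
  | cons a J =>
    rw [List.cons_append, listTerm_cons, listTerm_cons, tailTerm, tailTerm, tailTerm,
      List.map_append, List.prod_append]
    ring

theorem compLists_ne_nil {n : ℕ} (hn : 1 ≤ n) {L : List ℕ} (h : L ∈ compLists n) : L ≠ [] := by
  rintro rfl
  have := (mem_compLists.1 h).2
  simp at this
  omega

/-- The product of the composition sums of a path and a cycle, as a sum over the compositions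
with a prescribed partial sum. -/
theorem sum_listTerm_mul_sum {a b : ℕ} (ha : 1 ≤ a) (hb : 1 ≤ b) :
    (∑ J ∈ compLists a, listTerm e J)
        * (∑ K ∈ compLists b, ((listSurplusSum K 1 : R) - 1) * listTerm e K)
      = ∑ L ∈ compLists (a + b) with listSurplusSum L a = a,
          ((listSurplusSum L (a + 1) : R) - a) * listTerm e L := by
  rw [Finset.sum_mul_sum, ← Finset.sum_product']
  refine Finset.sum_bij (fun p _ ↦ p.1 ++ p.2) ?_ ?_ ?_ ?_
  · rintro ⟨J, K⟩ h
    simp only [Finset.mem_product, mem_compLists] at h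
    obtain ⟨⟨h1, rfl⟩, h3, rfl⟩ := h
    rw [Finset.mem_filter, mem_compLists]
    refine ⟨⟨?_, by simp⟩, listSurplusSum_append J K⟩
    intro i hi
    rcases List.mem_append.1 hi with hi | hi
    · exact h1 i hi
    · exact h3 i hi
  · rintro ⟨J, K⟩ h ⟨J', K'⟩ h' hJK
    simp only [Finset.mem_product, mem_compLists] at h h' hJK
    suffices hJ : J = J' by
      subst hJ
      rw [List.append_cancel_left hJK]
    -- Blocks are positive, so a composition can be cut at a given partial sum in only one way.
    have aux : ∀ {J J' K K' : List ℕ}, (∀ i ∈ J, 0 < i) → (∀ i ∈ J', 0 < i) →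
        J.sum = J'.sum → J ++ K = J' ++ K' → J = J' := by
      intro J
      induction J with
      | nil =>
        intro J' K K' _ h2 hs _
        cases J' with
        | nil => rfl
        | cons c J' =>
          have := h2 c (by simp)
          simp at hs
          omega
      | cons c J ih =>
        intro J' K K' h1 h2 hs hJ
        cases J' with
        | nil =>
          have := h1 c (by simp)
          simp at hs
          omega
        | cons c' J' =>
          simp only [List.cons_append, List.cons.injEq] at hJ
          obtain ⟨rfl, hJ⟩ := hJ
          rw [ih (fun i hi ↦ h1 i (by simp [hi])) (fun i hi ↦ h2 i (by simp [hi]))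
            (by simpa using hs) hJ]
    exact aux h.1.1 h'.1.1 (h.1.2.trans h'.1.2.symm) hJK
  · intro L hL
    rw [Finset.mem_filter, mem_compLists] at hL
    obtain ⟨⟨h1, h2⟩, h3⟩ := hL
    obtain ⟨J, K, rfl, hJ⟩ := exists_append_of_listSurplusSum_eq (by omega) h3
    refine ⟨(J, K), ?_, rfl⟩
    rw [List.sum_append] at h2
    simp only [Finset.mem_product, mem_compLists]
    exact ⟨⟨fun i hi ↦ h1 i (by simp [hi]), hJ⟩, fun i hi ↦ h1 i (by simp [hi]), by omega⟩
  · rintro ⟨J, K⟩ h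
    simp only [Finset.mem_product] at h
    obtain ⟨hJ, hK⟩ := h
    have hJ' := compLists_ne_nil ha hJ
    have hK' := compLists_ne_nil hb hK
    cases K with
    | nil => exact absurd rfl hK'
    | cons k K =>
      have hk := (mem_compLists.1 hK).1 k (by simp)
      obtain ⟨-, rfl⟩ := mem_compLists.1 hJ
      -- With k the first block of K, both sides contain k(k-1): on the left k comes from w_K and k
      -- - 1 from the surplus, while after concatenation k - 1 is part of the weight and k is the
      -- surplus factor.
      dsimp only
      rw [listSurplusSum_cons_one K hk, listSurplusSum_append_cons J K hk, listTerm_append e hJ',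
        listTerm_cons, tailTerm, tailTerm]
      simp only [List.map_cons, List.prod_cons]
      push_cast
      ring

end Compositions

/-! ### Expansions over compositions. -/

section Expansion

open PowerSeries

variable {R ι : Type*} [CommRing R] [Fintype ι] (x : ι → R)

theorem finEsymm_zero : finEsymm x 0 = 1 := by
  simp [finEsymm, esymmSeries, map_prod]

/-- The generating function of the sums of the products of the terms `(k - 1) e_k`. -/
def tailSeries : R⟦X⟧ := mk fun n ↦ ∑ L ∈ compLists n, tailTerm (finEsymm x) L

theorem coeff_succ_mul_tailSeries {f : R⟦X⟧} (hf : coeff 0 f = 0) (n : ℕ) :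
    coeff (n + 1) (f * tailSeries x)
      = ∑ k ∈ Finset.range (n + 1), ∑ L ∈ compLists (n - k),
          coeff (k + 1) f * tailTerm (finEsymm x) L := by
  rw [coeff_mul, Finset.Nat.sum_antidiagonal_succ, hf, zero_mul, zero_add,
    Finset.Nat.sum_antidiagonal_eq_sum_range_succ_mk]
  simp only [tailSeries, coeff_mk, Finset.mul_sum]

/-- This is the geometric series for 1/D, verified by splitting off the first block. -/
theorem pathDenom_mul_tailSeries : pathDenom x * tailSeries x = 1 := by
  have h0 : coeff 0 (pathDenom x - 1) = 0 := by
    rw [map_sub, coeff_pathDenom, finEsymm_zero]; simp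
  have h1 : pathDenom x * tailSeries x = (pathDenom x - 1) * tailSeries x + tailSeries x := by
    ring
  ext n
  rw [h1, map_add]
  cases n with
  | zero =>
    rw [coeff_mul]
    simp only [Finset.Nat.antidiagonal_zero, Finset.sum_singleton, h0, zero_mul, zero_add]
    simp [tailSeries, compLists_zero, tailTerm]
  | succ n =>
    rw [coeff_succ_mul_tailSeries x h0]
    rw [tailSeries, coeff_mk, sum_compLists_succ, ← Finset.sum_add_distrib, coeff_one,
      if_neg (Nat.succ_ne_zero n)]
    refine Finset.sum_eq_zero fun k _ ↦ ?_
    rw [← Finset.sum_add_distrib]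
    refine Finset.sum_eq_zero fun L _ ↦ ?_
    rw [map_sub, coeff_pathDenom, coeff_one, if_neg (Nat.succ_ne_zero k)]
    simp only [tailTerm, List.map_cons, List.prod_cons]
    push_cast
    ring

/-- Since E = D + tE', one has E/D = 1 + tE'/D. The factor tE' supplies the first block with weight
k e_k, and 1/D supplies the others. -/
theorem pathSum_eq (n : ℕ) : pathSum x n = ∑ L ∈ compLists n, listTerm (finEsymm x) L := by
  have h : mk (pathSum x) = 1 + euler (esymmSeries x) * tailSeries x := by
    have h1 := pathSum_mul_pathDenom x
    have h2 := pathDenom_mul_tailSeries x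
    have h3 : pathDenom x = esymmSeries x - euler (esymmSeries x) := rfl
    linear_combination tailSeries x * h1 + (1 - mk (pathSum x)) * h2 - tailSeries x * h3
  rw [← coeff_mk n (pathSum x), h]
  cases n with
  | zero =>
    rw [map_add, coeff_mul]
    simp [coeff_euler, compLists_zero, listTerm, listWeight]
  | succ n =>
    rw [map_add, coeff_succ_mul_tailSeries x (by simp [coeff_euler]), sum_compLists_succ,
      coeff_one, if_neg (Nat.succ_ne_zero n), zero_add]
    simp only [coeff_euler, listTerm_cons, finEsymm]

/-- In -tD'/D the first block has weight k(k-1) e_k, and k is the least partial sum that is at least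
1. -/
theorem cycleSum_eq {n : ℕ} (hn : 1 ≤ n) :
    cycleSum x n
      = ∑ L ∈ compLists n, ((listSurplusSum L 1 : R) - 1) * listTerm (finEsymm x) L := by
  obtain ⟨n, rfl⟩ := Nat.exists_eq_add_of_le' hn
  have h : cycleSeries x = -euler (pathDenom x) * tailSeries x := by
    have h1 := cycleSeries_mul_pathDenom x
    have h2 := pathDenom_mul_tailSeries x
    linear_combination tailSeries x * h1 - cycleSeries x * h2
  rw [← coeff_cycleSeries_succ, h,
    coeff_succ_mul_tailSeries x (by rw [map_neg, coeff_euler]; simp), sum_compLists_succ]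
  refine Finset.sum_congr rfl fun k _ ↦ Finset.sum_congr rfl fun L _ ↦ ?_
  rw [listTerm_cons, listSurplusSum_cons_one L k.succ_pos, map_neg, coeff_euler, coeff_pathDenom]
  push_cast
  ring

theorem pathSum_mul_cycleSum {l m : ℕ} (hl : 1 ≤ l) (hm : 1 ≤ m) :
    pathSum x l * cycleSum x m
      = ∑ L ∈ compLists (l + m) with listSurplusSum L l = l,
          ((listSurplusSum L (l + 1) : R) - l) * listTerm (finEsymm x) L := by
  rw [pathSum_eq, cycleSum_eq x hm, sum_listTerm_mul_sum _ hl hm]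

/-- The expansion of the weight sum of the proper colorings of a tadpole. -/
theorem tadpole_sum_eq (l : ℕ) {m : ℕ} (hm : 1 ≤ m) :
    cycleSum x m * pathSum x l - mergeSum x m l
      = ∑ L ∈ compLists (l + m),
          ((listSurplusSum L (l + 1) : R) - (l + 1)) * listTerm (finEsymm x) L := by
  induction l generalizing m with
  | zero =>
    have : mergeSum x m 0 = 0 := by simp [mergeSum]
    rw [this, pathSum_zero, cycleSum_eq x hm, mul_one, sub_zero]
    simp
  | succ l ih =>
    have h := ih (m := m + 1) (by omega)
    have h2 := pathSum_mul_cycleSum x (l := l + 1) (by omega) hm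
    rw [mergeSum_succ]
    rw [show l + 1 + m = l + (m + 1) by ring] at h2 ⊢
    have h3 : cycleSum x m * pathSum x (l + 1)
        - (pathSum x (m + 1 + l) - cycleSum x (m + 1) * pathSum x l + mergeSum x (m + 1) l)
        = pathSum x (l + 1) * cycleSum x m - pathSum x (l + (m + 1))
          + (cycleSum x (m + 1) * pathSum x l - mergeSum x (m + 1) l) := by
      rw [show m + 1 + l = l + (m + 1) by ring]; ring
    rw [h3, h, h2, pathSum_eq, Finset.sum_filter, ← Finset.sum_sub_distrib,
      ← Finset.sum_add_distrib]
    -- Write σ for the surplus sum. If l + 1 is a partial sum, the coefficients add up as (σ(l+2) -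
    -- (l+1)) - 1 + 0. Otherwise σ(l+2) = σ(l+1), and only -1 + (σ(l+1) - (l+1)) remains.
    refine Finset.sum_congr rfl fun L _ ↦ ?_
    split_ifs with hL
    · rw [hL]; push_cast; ring
    · rw [listSurplusSum_succ_of_ne hL]; push_cast; ring

/-- The expansion of the weight sum of the proper colorings of the line graph of a tadpole. -/
theorem lineGraph_sum_eq {l m : ℕ} (hl : 1 ≤ l) (hm : 1 ≤ m) :
    cycleSum x m * pathSum x l - 2 * mergeSum x m l
      = (∑ L ∈ compLists (l + m) with listSurplusSum L l = l,
          ((listSurplusSum L (l + 1) : R) - (l + 1) - 1) * listTerm (finEsymm x) L)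
        + 2 * ∑ L ∈ compLists (l + m) with l + 2 ≤ listSurplusSum L l,
          ((listSurplusSum L (l + 1) : R) - (l + 1)) * listTerm (finEsymm x) L := by
  have h : cycleSum x m * pathSum x l - 2 * mergeSum x m l
      = 2 * (cycleSum x m * pathSum x l - mergeSum x m l) - pathSum x l * cycleSum x m := by
    ring
  rw [h, tadpole_sum_eq x l hm, pathSum_mul_cycleSum x hl hm, Finset.sum_filter,
    Finset.sum_filter, Finset.sum_filter, Finset.mul_sum, Finset.mul_sum,
    ← Finset.sum_sub_distrib, ← Finset.sum_add_distrib]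
  refine Finset.sum_congr rfl fun L hL ↦ ?_
  have hle : l ≤ listSurplusSum L l :=
    le_listSurplusSum (by have := (mem_compLists.1 hL).2; omega)
  -- If l is a partial sum, then 2Θ(l+1) - (Θ(l+1) + 1) = Θ(l+1) - 1. Otherwise the coefficient is
  -- 2Θ(l+1), which vanishes when Θ(l) = 1.
  by_cases h1 : listSurplusSum L l = l
  · rw [if_pos h1, if_pos h1, if_neg (by omega)]
    ring
  · rw [if_neg h1, if_neg h1, listSurplusSum_succ_of_ne h1]
    split_ifs with h2
    · ring
    · rw [show listSurplusSum L l = l + 1 by omega]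
      push_cast
      ring

end Expansion

/-! ### The recursive sums as sums over colorings. -/

section ColoringSums

variable {R ι : Type*} [CommRing R] (x : ι → R)

/-- Consecutive vertices have distinct colors. -/
def IsPathColoring {n : ℕ} (α : Fin n → ι) : Prop :=
  ∀ i j : Fin n, (i : ℕ) + 1 = j → α i ≠ α j

/-- Cyclically consecutive vertices have distinct colors. -/
def IsCycleColoring {n : ℕ} (α : Fin (n + 2) → ι) : Prop := ∀ i, α i ≠ α (i + 1)

/-- The weight of a coloring of a path, and `0` if it is not proper. -/
def pathWeight {n : ℕ} (α : Fin n → ι) : R :=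
  open Classical in if IsPathColoring α then ∏ i, x (α i) else 0

/-- The weight of a coloring of a cycle, and `0` if it is not proper. -/
def cycleWeight {n : ℕ} (α : Fin (n + 2) → ι) : R :=
  open Classical in if IsCycleColoring α then ∏ i, x (α i) else 0

theorem isPathColoring_cons {n : ℕ} (c : ι) (f : Fin (n + 1) → ι) :
    IsPathColoring (Fin.cons c f : Fin (n + 2) → ι) ↔ c ≠ f 0 ∧ IsPathColoring f := by
  constructor
  · intro h
    refine ⟨h 0 1 (by simp), fun i j hij ↦ ?_⟩
    simpa using h i.succ j.succ (by simp [hij])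
  · rintro ⟨h1, h2⟩ i j hij
    cases j using Fin.cases with
    | zero => simp at hij
    | succ j =>
      cases i using Fin.cases with
      | zero =>
        have : j = 0 := Fin.ext (by simpa using hij.symm)
        subst this
        simpa using h1
      | succ i => simpa using h2 i j (by simpa using hij)

theorem isPathColoring_snoc {n : ℕ} (f : Fin (n + 1) → ι) (c : ι) :
    IsPathColoring (Fin.snoc f c : Fin (n + 2) → ι)
      ↔ f (Fin.last n) ≠ c ∧ IsPathColoring f := by
  constructor
  · intro h
    refine ⟨?_, fun i j hij ↦ ?_⟩
    · simpa using h (Fin.last n).castSucc (Fin.last (n + 1)) (by simp)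
    · simpa using h i.castSucc j.castSucc (by simp [hij])
  · rintro ⟨h1, h2⟩ i j hij
    cases i using Fin.lastCases with
    | last =>
      have := j.isLt
      simp at hij
      omega
    | cast i =>
      cases j using Fin.lastCases with
      | last =>
        have : i = Fin.last n := Fin.ext (by simpa using hij)
        subst this
        simpa using h1
      | cast j => simpa using h2 i j (by simpa using hij)

theorem isCycleColoring_iff {n : ℕ} (α : Fin (n + 2) → ι) :
    IsCycleColoring α ↔ IsPathColoring α ∧ α (Fin.last (n + 1)) ≠ α 0 := by
  constructor
  · intro h
    refine ⟨fun i j hij ↦ ?_, ?_⟩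
    · have : j = i + 1 := by
        ext
        rw [Fin.val_add_one_of_lt (by rw [Fin.lt_def]; have := j.isLt; simp; omega), hij]
      rw [this]
      exact h i
    · simpa using h (Fin.last (n + 1))
  · rintro ⟨h1, h2⟩ i
    by_cases hi : i = Fin.last (n + 1)
    · subst hi
      simpa using h2
    · refine h1 i (i + 1) ?_
      rw [Fin.val_add_one_of_lt (Fin.lt_last_iff_ne_last.2 hi)]

theorem pathWeight_cons [DecidableEq ι] {n : ℕ} (c : ι) (f : Fin (n + 1) → ι) :
    pathWeight x (Fin.cons c f : Fin (n + 2) → ι)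
      = if c = f 0 then 0 else x c * pathWeight x f := by
  rw [pathWeight, pathWeight, isPathColoring_cons, Fin.prod_univ_succ]
  by_cases h1 : c = f 0 <;> by_cases h2 : IsPathColoring f <;> simp [h1, h2]

theorem pathWeight_snoc [DecidableEq ι] {n : ℕ} (f : Fin (n + 1) → ι) (c : ι) :
    pathWeight x (Fin.snoc f c : Fin (n + 2) → ι)
      = if f (Fin.last n) = c then 0 else x c * pathWeight x f := by
  rw [pathWeight, pathWeight, isPathColoring_snoc, Fin.prod_univ_castSucc]
  by_cases h1 : f (Fin.last n) = c <;> by_cases h2 : IsPathColoring f <;> simp [h1, h2, mul_comm]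

theorem cycleWeight_eq [DecidableEq ι] {n : ℕ} (α : Fin (n + 2) → ι) :
    cycleWeight x α = if α (Fin.last (n + 1)) = α 0 then 0 else pathWeight x α := by
  rw [cycleWeight, pathWeight, isCycleColoring_iff]
  by_cases h1 : α (Fin.last (n + 1)) = α 0 <;> by_cases h2 : IsPathColoring α <;> simp [h1, h2]

/-- Rotational symmetry allows the root of the cycle to be any vertex, as needed for two neighboring
attachment vertices. -/
theorem cycleWeight_rotate {n : ℕ} (α : Fin (n + 2) → ι) (k : Fin (n + 2)) :
    cycleWeight x (fun i ↦ α (i + k)) = cycleWeight x α := by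
  have h : IsCycleColoring (fun i ↦ α (i + k)) ↔ IsCycleColoring α := by
    constructor
    · intro h i
      have := h (i - k)
      simpa [sub_add_eq_add_sub] using this
    · intro h i
      have := h (i + k)
      simpa [add_right_comm] using this
  have hp : ∏ i, x (α (i + k)) = ∏ i, x (α i) :=
    Fintype.prod_equiv (Equiv.addRight k) _ _ fun i ↦ by simp
  rw [cycleWeight, cycleWeight, h, hp]

variable [Fintype ι]

theorem sum_fun_cons {M : Type*} [AddCommMonoid M] {n : ℕ} (F : (Fin (n + 1) → ι) → M) :
    ∑ f, F f = ∑ c, ∑ f : Fin n → ι, F (Fin.cons c f) := by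
  rw [← Fintype.sum_prod_type' (f := fun c (f : Fin n → ι) ↦ F (Fin.cons c f))]
  exact (Fintype.sum_equiv (Fin.consEquiv fun _ ↦ ι) _ _ fun _ ↦ rfl).symm

theorem sum_fun_snoc {M : Type*} [AddCommMonoid M] {n : ℕ} (F : (Fin (n + 1) → ι) → M) :
    ∑ f, F f = ∑ c, ∑ f : Fin n → ι, F (Fin.snoc f c) := by
  rw [← Fintype.sum_prod_type' (f := fun c (f : Fin n → ι) ↦ F (Fin.snoc f c))]
  exact (Fintype.sum_equiv (Fin.snocEquiv fun _ ↦ ι) _ _ fun _ ↦ rfl).symm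

theorem sum_pathWeight_cons (n : ℕ) (c : ι) :
    ∑ f : Fin n → ι, pathWeight x (Fin.cons c f : Fin (n + 1) → ι) = headPath x (n + 1) c := by
  classical
  induction n generalizing c with
  | zero =>
    rw [headPath_succ]
    have h : ∀ α : Fin 1 → ι, IsPathColoring α := fun α i j hij ↦ by omega
    simp [pathWeight, h]
  | succ n ih =>
    rw [sum_fun_cons, headPath_succ, pathSum_succ]
    simp only [pathWeight_cons, Fin.cons_zero]
    have h : ∀ b, (∑ f : Fin n → ι, if c = b then 0 else
        x c * pathWeight x (Fin.cons b f : Fin (n + 1) → ι))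
        = if c = b then 0 else x c * headPath x (n + 1) b := fun b ↦ by
      split_ifs with hb
      · simp
      · rw [← Finset.mul_sum, ih]
    simp only [h]
    rw [mul_sub, Finset.mul_sum, eq_sub_iff_add_eq,
      ← Finset.add_sum_erase _ _ (Finset.mem_univ c),
      ← Finset.add_sum_erase Finset.univ (fun b ↦ x c * headPath x (n + 1) b) (Finset.mem_univ c),
      if_pos rfl, zero_add, add_comm]
    congr 1
    refine Finset.sum_congr rfl fun b hb ↦ if_neg ?_
    exact (Finset.ne_of_mem_erase hb).symm

/-- Among path colorings starting with c, those that also end with c lose their last vertex, leaving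
a factor x_c and a shorter path that does not end with c. This is the recursion of `rootedCycle`. -/
theorem sum_ite_cons_last [DecidableEq ι] (n : ℕ) (c : ι) :
    (∑ f : Fin n → ι, if (Fin.cons c f : Fin (n + 1) → ι) (Fin.last n) = c then 0
        else pathWeight x (Fin.cons c f : Fin (n + 1) → ι)) = rootedCycle x (n + 1) c := by
  induction n with
  | zero =>
    rw [rootedCycle_succ, headPath_succ]
    simp
  | succ n ih =>
    rw [rootedCycle_succ, ← ih, ← sum_pathWeight_cons, eq_sub_iff_add_eq, sum_fun_snoc,
      sum_fun_snoc, ← Finset.add_sum_erase _ _ (Finset.mem_univ c),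
      ← Finset.add_sum_erase Finset.univ (fun b ↦ ∑ f : Fin n → ι,
        pathWeight x (Fin.cons c (Fin.snoc f b : Fin (n + 1) → ι) : Fin (n + 2) → ι))
        (Finset.mem_univ c)]
    simp only [Fin.cons_snoc_eq_snoc_cons, Fin.snoc_last, if_true, Finset.sum_const_zero,
      zero_add, pathWeight_snoc]
    rw [add_comm, Finset.mul_sum]
    congr 1
    · refine Finset.sum_congr rfl fun f _ ↦ ?_
      split_ifs <;> simp
    · refine Finset.sum_congr rfl fun b hb ↦ Finset.sum_congr rfl fun f _ ↦ ?_
      rw [if_neg (Finset.ne_of_mem_erase hb)]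

theorem sum_pathWeight_head [DecidableEq ι] (n : ℕ) (c : ι) :
    (∑ β : Fin (n + 1) → ι, if β 0 = c then pathWeight x β else 0) = headPath x (n + 1) c := by
  rw [← sum_pathWeight_cons, sum_fun_cons, Finset.sum_eq_single c]
  · simp
  · intro b _ hb
    simp [hb]
  · simp

theorem sum_cycleWeight_root [DecidableEq ι] (n : ℕ) (c : ι) (k : Fin (n + 2)) :
    (∑ α : Fin (n + 2) → ι, if α k = c then cycleWeight x α else 0)
      = rootedCycle x (n + 2) c := by
  have h : (∑ α : Fin (n + 2) → ι, if α k = c then cycleWeight x α else 0)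
      = ∑ α : Fin (n + 2) → ι, if α 0 = c then cycleWeight x α else 0 := by
    refine Fintype.sum_equiv (Equiv.arrowCongr (Equiv.addRight (-k)) (Equiv.refl ι)) _ _
      fun α ↦ ?_
    have : (Equiv.arrowCongr (Equiv.addRight (-k)) (Equiv.refl ι)) α = fun i ↦ α (i + k) := by
      ext i
      simp [Equiv.arrowCongr]
    rw [this, cycleWeight_rotate]
    simp only [zero_add]
  rw [h, ← sum_ite_cons_last, sum_fun_cons, Finset.sum_eq_single c]
  · simp [cycleWeight_eq]
  · intro b _ hb
    simp [hb]
  · simp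

theorem sum_pathWeight (n : ℕ) :
    ∑ β : Fin (n + 1) → ι, pathWeight x β = pathSum x (n + 1) := by
  classical
  rw [pathSum_succ, sum_fun_cons]
  exact Finset.sum_congr rfl fun c _ ↦ sum_pathWeight_cons x n c

theorem sum_cycleWeight (n : ℕ) :
    ∑ α : Fin (n + 2) → ι, cycleWeight x α = cycleSum x (n + 2) := by
  classical
  rw [cycleSum]
  simp only [← sum_cycleWeight_root x n _ 0]
  rw [Finset.sum_comm]
  simp

theorem sum_cycleWeight_mul_pathWeight_merge [DecidableEq ι] (m l : ℕ) (k : Fin (m + 2)) :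
    (∑ α : Fin (m + 2) → ι, ∑ β : Fin (l + 1) → ι,
      if β 0 = α k then cycleWeight x α * pathWeight x β else 0) = mergeSum x (m + 2) (l + 1) := by
  simp only [mergeSum, ← sum_cycleWeight_root x m _ k, ← sum_pathWeight_head, Finset.sum_mul_sum]
  symm
  rw [Finset.sum_comm]
  refine Finset.sum_congr rfl fun α _ ↦ ?_
  rw [Finset.sum_comm]
  refine Finset.sum_congr rfl fun β _ ↦ ?_
  rw [Finset.sum_eq_single (α k)]
  · simp
  · intro b _ hb
    simp [hb.symm]
  · simp

/-- Neighboring cycle vertices have different colors, so the first path vertex cannot agree with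
both, and inclusion-exclusion has no third term. -/
theorem sum_cycleWeight_mul_pathWeight [DecidableEq ι] (m l : ℕ) (k : Fin (m + 2)) :
    (∑ α : Fin (m + 2) → ι, ∑ β : Fin (l + 1) → ι,
      if β 0 ≠ α k ∧ β 0 ≠ α (k + 1) then cycleWeight x α * pathWeight x β else 0)
      = cycleSum x (m + 2) * pathSum x (l + 1) - 2 * mergeSum x (m + 2) (l + 1) := by
  rw [two_mul, ← sub_sub]
  nth_rw 1 [← sum_cycleWeight_mul_pathWeight_merge x m l k]
  rw [← sum_cycleWeight_mul_pathWeight_merge x m l (k + 1), ← sum_cycleWeight, ← sum_pathWeight,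
    Finset.sum_mul_sum]
  simp only [← Finset.sum_sub_distrib]
  refine Finset.sum_congr rfl fun α _ ↦ Finset.sum_congr rfl fun β _ ↦ ?_
  by_cases hα : IsCycleColoring α
  · have := hα k
    by_cases h1 : β 0 = α k
    · have h2 : β 0 ≠ α (k + 1) := h1 ▸ this
      simp [h1, this]
    · by_cases h2 : β 0 = α (k + 1)
      · simp [h2, this.symm]
      · simp [h1, h2]
  · simp [cycleWeight, hα]

end ColoringSums

/-! ### The line graph of the tadpole. -/

section LineGraph

theorem tadpole_inc_iff (m l e v : ℕ) :
    (tadpole m l).Inc e v ↔ e < m + l ∧ v ∈ tadpoleEnds m e := by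
  constructor
  · rintro ⟨y, h1, h2⟩
    exact ⟨h1, h2 ▸ Sym2.mem_mk_left v y⟩
  · rintro ⟨h1, y, hy⟩
    exact ⟨y, h1, hy⟩

/-- Besides consecutive edges, the pairs that meet are the first and last cycle edges, at vertex 0,
and the cycle edge m - 2 with the connecting edge m, at vertex m - 1. -/
theorem tadpoleEnds_common_iff {m e f : ℕ} (hm : 2 ≤ m) (hef : e < f) :
    (∃ v, v ∈ tadpoleEnds m e ∧ v ∈ tadpoleEnds m f)
      ↔ f = e + 1 ∨ (e = 0 ∧ f + 1 = m) ∨ (e + 2 = m ∧ f = m) := by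
  have hmod : ∀ k < m, (k + 1 < m ∧ (k + 1) % m = k + 1) ∨ (k + 1 = m ∧ (k + 1) % m = 0) := by
    intro k hk
    rcases Nat.lt_or_ge (k + 1) m with h | h
    · exact Or.inl ⟨h, Nat.mod_eq_of_lt h⟩
    · have h : k + 1 = m := by omega
      exact Or.inr ⟨h, by rw [h, Nat.mod_self]⟩
  have key : ∀ a b c d : ℕ, (∃ v, v ∈ s(a, b) ∧ v ∈ s(c, d))
      ↔ a = c ∨ a = d ∨ b = c ∨ b = d := by
    intro a b c d
    simp only [Sym2.mem_iff]
    constructor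
    · rintro ⟨v, rfl | rfl, rfl | rfl⟩ <;> simp
    · rintro (rfl | rfl | rfl | rfl)
      · exact ⟨a, by simp⟩
      · exact ⟨a, by simp⟩
      · exact ⟨b, by simp⟩
      · exact ⟨b, by simp⟩
  unfold tadpoleEnds
  split_ifs with h1 h2 h2
  · rw [key]
    have := hmod e h1
    have := hmod f h2
    omega
  · rw [key]
    have := hmod e h1
    omega
  · omega
  · rw [key]
    omega

/-- Adjacent vertices have distinct colors. -/
def IsProperColoring {V ι : Type*} (G : SimpleGraph V) (κ : V → ι) : Prop :=
  ∀ u v, G.Adj u v → κ u ≠ κ v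

/-- The weight sum of the proper colorings of a graph with finitely many colors. -/
def colorSum {V R ι : Type*} [Fintype V] [DecidableEq V] [CommRing R] [Fintype ι] (G : SimpleGraph V)
    (x : ι → R) : R :=
  open Classical in ∑ κ : V → ι, if IsProperColoring G κ then ∏ v, x (κ v) else 0

/-- The edges of a tadpole are those of the cycle and the others. -/
def tadpoleEdgeEquiv (m l : ℕ) : Fin m ⊕ Fin l ≃ (tadpole m l).edgeSet :=
  finSumFinEquiv.trans Fin.equivSubtype

theorem tadpoleEdgeEquiv_inl {m l : ℕ} (i : Fin m) :
    (tadpoleEdgeEquiv m l (Sum.inl i) : ℕ) = i := rfl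

theorem tadpoleEdgeEquiv_inr {m l : ℕ} (i : Fin l) :
    (tadpoleEdgeEquiv m l (Sum.inr i) : ℕ) = m + i := rfl

theorem multiLineGraph_tadpole_adj_iff {m l : ℕ} (hm : 2 ≤ m) {e f : (tadpole m l).edgeSet}
    (hef : (e : ℕ) < f) :
    (multiLineGraph (tadpole m l)).Adj e f
      ↔ (f : ℕ) = e + 1 ∨ ((e : ℕ) = 0 ∧ (f : ℕ) + 1 = m) ∨ ((e : ℕ) + 2 = m ∧ (f : ℕ) = m) := by
  have he : (e : ℕ) < m + l := e.2
  have hf : (f : ℕ) < m + l := f.2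
  rw [← tadpoleEnds_common_iff hm hef]
  change (e ≠ f ∧ ∃ v, _ ∧ _) ↔ _
  simp only [tadpole_inc_iff, he, hf, true_and]
  refine and_iff_right ?_
  rintro rfl
  exact lt_irrefl _ hef

theorem isProperColoring_lineGraph_tadpole_iff {ι : Type*} {m l : ℕ} (κ : (tadpole (m + 2) (l + 1)).edgeSet → ι)
    {α : Fin (m + 2) → ι} {β : Fin (l + 1) → ι}
    (hα : ∀ i, κ (tadpoleEdgeEquiv _ _ (Sum.inl i)) = α i)
    (hβ : ∀ i, κ (tadpoleEdgeEquiv _ _ (Sum.inr i)) = β i) :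
    IsProperColoring (multiLineGraph (tadpole (m + 2) (l + 1))) κ
      ↔ IsCycleColoring α ∧ IsPathColoring β ∧ β 0 ≠ α (Fin.last m).castSucc
        ∧ β 0 ≠ α (Fin.last (m + 1)) := by
  rw [isCycleColoring_iff]
  constructor
  · intro h
    have h' : ∀ a b, ((tadpoleEdgeEquiv (m + 2) (l + 1) a : ℕ) < tadpoleEdgeEquiv _ _ b) → _ →
        κ (tadpoleEdgeEquiv _ _ a) ≠ κ (tadpoleEdgeEquiv _ _ b) := fun a b hab hab' ↦
      h _ _ ((multiLineGraph_tadpole_adj_iff (by omega) hab).2 hab')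
    refine ⟨⟨fun i j hij ↦ ?_, ?_⟩, fun i j hij ↦ ?_, ?_, ?_⟩
    · rw [← hα, ← hα]
      apply h' <;> simp only [tadpoleEdgeEquiv_inl] <;> omega
    · rw [← hα, ← hα]
      apply Ne.symm
      apply h' <;> simp only [tadpoleEdgeEquiv_inl] <;> simp
    · rw [← hβ, ← hβ]
      apply h' <;> simp only [tadpoleEdgeEquiv_inr] <;> omega
    · rw [← hα, ← hβ]
      apply Ne.symm
      apply h' <;> simp only [tadpoleEdgeEquiv_inl, tadpoleEdgeEquiv_inr] <;> simp
    · rw [← hα, ← hβ]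
      apply Ne.symm
      apply h' <;> simp only [tadpoleEdgeEquiv_inl, tadpoleEdgeEquiv_inr] <;> simp
  · rintro ⟨⟨h1, h2⟩, h3, h4, h5⟩
    have key : ∀ u v : (tadpole (m + 2) (l + 1)).edgeSet, (u : ℕ) < v → (multiLineGraph (tadpole (m + 2) (l + 1))).Adj u v →
        κ u ≠ κ v := by
      intro u v huv hadj
      rw [multiLineGraph_tadpole_adj_iff (by omega) huv] at hadj
      obtain ⟨a, rfl⟩ := (tadpoleEdgeEquiv _ _).surjective u
      obtain ⟨b, rfl⟩ := (tadpoleEdgeEquiv _ _).surjective v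
      rcases a with i | i <;> rcases b with j | j <;>
        simp only [tadpoleEdgeEquiv_inl, tadpoleEdgeEquiv_inr] at huv hadj <;>
        simp only [hα, hβ]
      · rcases hadj with h | ⟨h, h'⟩ | ⟨h, h'⟩
        · exact h1 i j h.symm
        · have hi : i = 0 := Fin.ext (by simpa using h)
          have hj : j = Fin.last (m + 1) := Fin.ext (by simpa using h')
          rw [hi, hj]
          exact h2.symm
        · omega
      · have hj : j = 0 := Fin.ext (show (j : ℕ) = 0 by omega)
        subst hj
        rcases hadj with h | ⟨h, h'⟩ | ⟨h, h'⟩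
        · have hi : i = Fin.last (m + 1) := Fin.ext (by simp at h ⊢; omega)
          rw [hi]
          exact h5.symm
        · omega
        · have hi : i = (Fin.last m).castSucc := Fin.ext (by simp at h ⊢; omega)
          rw [hi]
          exact h4.symm
      · omega
      · exact h3 i j (by omega)
    intro u v hadj
    rcases lt_trichotomy (u : ℕ) v with h | h | h
    · exact key u v h hadj
    · exact absurd (Subtype.ext h) hadj.ne
    · exact (key v u h hadj.symm).symm

theorem colorSum_lineGraph_tadpole {R ι : Type*} [CommRing R] [Fintype ι] (x : ι → R) (m l : ℕ)
    [Fintype (tadpole (m + 2) (l + 1)).edgeSet] :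
    colorSum (multiLineGraph (tadpole (m + 2) (l + 1))) x
      = cycleSum x (m + 2) * pathSum x (l + 1) - 2 * mergeSum x (m + 2) (l + 1) := by
  classical
  rw [← sum_cycleWeight_mul_pathWeight x m l (Fin.last m).castSucc, colorSum,
    ← Fintype.sum_prod_type' (f := fun (α : Fin (m + 2) → ι) (β : Fin (l + 1) → ι) ↦ _)]
  refine Fintype.sum_equiv (((tadpoleEdgeEquiv _ _).symm.arrowCongr (Equiv.refl ι)).trans
    (Equiv.sumArrowEquivProdArrow _ _ _)) _ _ fun κ ↦ ?_
  set α : Fin (m + 2) → ι := fun i ↦ κ (tadpoleEdgeEquiv _ _ (Sum.inl i)) with hα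
  set β : Fin (l + 1) → ι := fun i ↦ κ (tadpoleEdgeEquiv _ _ (Sum.inr i)) with hβ
  have h : (((tadpoleEdgeEquiv _ _).symm.arrowCongr (Equiv.refl ι)).trans
    (Equiv.sumArrowEquivProdArrow _ _ _)) κ = (α, β) := rfl
  have hprod : ∏ v, x (κ v) = (∏ i, x (α i)) * ∏ i, x (β i) := by
    rw [← Fintype.prod_equiv (tadpoleEdgeEquiv _ _) (fun a ↦ x (κ (tadpoleEdgeEquiv _ _ a))) _
      fun _ ↦ rfl, Fintype.prod_sum_type]
  have hlast : (Fin.last m).castSucc + 1 = Fin.last (m + 1) := by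
    simp
  rw [h]
  simp only [isProperColoring_lineGraph_tadpole_iff κ (α := α) (β := β) (fun _ ↦ rfl)
    (fun _ ↦ rfl), hprod, hlast, cycleWeight, pathWeight]
  by_cases h1 : IsCycleColoring α <;> by_cases h2 : IsPathColoring β <;> simp [h1, h2]

end LineGraph

/-! ### Reduction to finitely many variables. -/

section Truncation

open MvPowerSeries

/-- Two power series have the same coefficients at the monomials in the first `N` variables. -/
def TruncEq (N : ℕ) (f g : MvPowerSeries ℕ ℚ) : Prop :=
  ∀ d : ℕ →₀ ℕ, (∀ i, N ≤ i → d i = 0) → coeff d f = coeff d g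

theorem TruncEq.refl (N : ℕ) (f : MvPowerSeries ℕ ℚ) : TruncEq N f f := fun _ _ ↦ rfl

theorem TruncEq.symm {N : ℕ} {f g : MvPowerSeries ℕ ℚ} (h : TruncEq N f g) : TruncEq N g f :=
  fun d hd ↦ (h d hd).symm

theorem TruncEq.trans {N : ℕ} {f g h : MvPowerSeries ℕ ℚ} (h1 : TruncEq N f g)
    (h2 : TruncEq N g h) : TruncEq N f h :=
  fun d hd ↦ (h1 d hd).trans (h2 d hd)

/-- Each monomial involves only finitely many variables. -/
theorem eq_of_forall_truncEq {f g : MvPowerSeries ℕ ℚ} (h : ∀ N, TruncEq N f g) : f = g := by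
  ext d
  refine h (d.support.sup id + 1) d fun i hi ↦ ?_
  by_contra hne
  have := Finset.le_sup (f := id) (Finsupp.mem_support_iff.2 hne)
  simp at this
  omega

theorem TruncEq.add {N : ℕ} {f g f' g' : MvPowerSeries ℕ ℚ} (h : TruncEq N f g)
    (h' : TruncEq N f' g') : TruncEq N (f + f') (g + g') := fun d hd ↦ by
  rw [map_add, map_add, h d hd, h' d hd]

theorem TruncEq.mul {N : ℕ} {f g f' g' : MvPowerSeries ℕ ℚ} (h : TruncEq N f g)
    (h' : TruncEq N f' g') : TruncEq N (f * f') (g * g') := fun d hd ↦ by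
  rw [coeff_mul, coeff_mul]
  refine Finset.sum_congr rfl fun p hp ↦ ?_
  rw [Finset.HasAntidiagonal.mem_antidiagonal] at hp
  have hp' : ∀ i, p.1 i + p.2 i = d i := fun i ↦ by rw [← hp]; rfl
  rw [h p.1 fun i hi ↦ ?_, h' p.2 fun i hi ↦ ?_]
  · have := hp' i
    have := hd i hi
    omega
  · have := hp' i
    have := hd i hi
    omega

theorem TruncEq.smul {N : ℕ} {f g : MvPowerSeries ℕ ℚ} (q : ℚ) (h : TruncEq N f g) :
    TruncEq N (q • f) (q • g) := fun d hd ↦ by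
  rw [coeff_smul, coeff_smul, h d hd]

theorem TruncEq.sum {N : ℕ} {α : Type*} (s : Finset α) {f g : α → MvPowerSeries ℕ ℚ}
    (h : ∀ a ∈ s, TruncEq N (f a) (g a)) : TruncEq N (∑ a ∈ s, f a) (∑ a ∈ s, g a) :=
  fun d hd ↦ by
    rw [map_sum, map_sum]
    exact Finset.sum_congr rfl fun a ha ↦ h a ha d hd

theorem TruncEq.list_prod {N : ℕ} {f g : ℕ → MvPowerSeries ℕ ℚ} (h : ∀ k, TruncEq N (f k) (g k))
    (L : List ℕ) : TruncEq N (L.map f).prod (L.map g).prod := by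
  induction L with
  | nil => exact TruncEq.refl N _
  | cons a L ih =>
    simp only [List.map_cons, List.prod_cons]
    exact (h a).mul ih

/-- The first `N` variables. -/
def finVar (N : ℕ) (c : Fin N) : MvPowerSeries ℕ ℚ := X (c : ℕ)

theorem prod_finVar {N : ℕ} {V : Type*} (s : Finset V) (κ : V → Fin N) :
    ∏ v ∈ s, finVar N (κ v) = monomial (∑ v ∈ s, Finsupp.single (κ v : ℕ) 1) (1 : ℚ) := by
  classical
  induction s using Finset.induction_on with
  | empty => simp
  | insert a s ha ih =>
    rw [Finset.prod_insert ha, Finset.sum_insert ha, ih, finVar, X, monomial_mul_monomial, one_mul]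

theorem finEsymm_finVar (N k : ℕ) :
    finEsymm (finVar N) k
      = ∑ s : Finset (Fin N), if s.card = k then ∏ c ∈ s, finVar N c else 0 := by
  rw [finEsymm, esymmSeries, Finset.prod_one_add, map_sum, Finset.powerset_univ]
  refine Finset.sum_congr rfl fun s _ ↦ ?_
  rw [Finset.prod_mul_distrib, Finset.prod_const, ← map_prod, PowerSeries.coeff_C_mul,
    PowerSeries.coeff_X_pow]
  by_cases h : k = s.card
  · simp [h]
  · simp [h, Ne.symm h]

theorem sum_single_one_apply {N : ℕ} (s : Finset (Fin N)) (i : ℕ) :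
    (∑ c ∈ s, Finsupp.single (c : ℕ) 1 : ℕ →₀ ℕ) i
      = if ∃ c ∈ s, (c : ℕ) = i then 1 else 0 := by
  classical
  rw [Finsupp.finsetSum_apply]
  split_ifs with h
  · obtain ⟨c, hc, rfl⟩ := h
    rw [Finset.sum_eq_single_of_mem c hc]
    · simp
    · intro b _ hb
      simp [Fin.val_inj, hb]
  · refine Finset.sum_eq_zero fun c hc ↦ ?_
    rw [Finsupp.single_apply, if_neg]
    exact fun hci ↦ h ⟨c, hc, hci⟩

theorem truncEq_elemSymm (N k : ℕ) : TruncEq N (elemSymm k) (finEsymm (finVar N) k) := by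
  classical
  intro d hd
  rw [finEsymm_finVar, map_sum]
  change (if (∀ i, d i ≤ 1) ∧ d.degree = k then (1 : ℚ) else 0) = _
  have hterm : ∀ s : Finset (Fin N),
      coeff d (if s.card = k then ∏ c ∈ s, finVar N c else 0)
        = if s.card = k ∧ d = ∑ c ∈ s, Finsupp.single (c : ℕ) 1 then (1 : ℚ) else 0 := by
    intro s
    by_cases h : s.card = k
    · rw [if_pos h, prod_finVar s (fun c ↦ c), coeff_monomial]
      simp [h]
    · simp [h]
  simp only [hterm]
  have hdeg : ∀ s : Finset (Fin N),
      (∑ c ∈ s, Finsupp.single (c : ℕ) 1 : ℕ →₀ ℕ).degree = s.card := by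
    intro s
    rw [map_sum]
    simp
  split_ifs with h
  · obtain ⟨h1, h2⟩ := h
    -- A squarefree exponent supported below N is the indicator of the set where it equals 1, so
    -- exactly one subset contributes.
    have hds : d = ∑ c ∈ Finset.univ.filter (fun c : Fin N ↦ d c = 1),
        Finsupp.single (c : ℕ) 1 := by
      ext i
      rw [sum_single_one_apply]
      split_ifs with hi
      · obtain ⟨c, hc, rfl⟩ := hi
        simpa using hc
      · by_contra hne
        have hiN : i < N := by
          by_contra hge
          exact hne (hd i (by omega))
        refine hi ⟨⟨i, hiN⟩, ?_, rfl⟩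
        have := h1 i
        simp
        omega
    have hcard : (Finset.univ.filter (fun c : Fin N ↦ d c = 1)).card = k := by
      rw [← hdeg, ← hds, h2]
    rw [Finset.sum_eq_single_of_mem (Finset.univ.filter (fun c : Fin N ↦ d c = 1))
      (Finset.mem_univ _), if_pos ⟨hcard, hds⟩]
    intro s _ hs
    rw [if_neg]
    rintro ⟨-, rfl⟩
    refine hs ?_
    ext c
    rw [Finset.mem_filter, sum_single_one_apply]
    simp [Fin.val_inj]
  · symm
    refine Finset.sum_eq_zero fun s _ ↦ if_neg ?_
    rintro ⟨rfl, rfl⟩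
    refine h ⟨fun i ↦ ?_, hdeg s⟩
    rw [sum_single_one_apply]
    split_ifs <;> omega

theorem truncEq_chromaticSymm {V : Type*} [Fintype V] [DecidableEq V] (G : SimpleGraph V)
    (N : ℕ) : TruncEq N (chromaticSymm G) (colorSum G (finVar N)) := by
  classical
  intro d hd
  rw [colorSum, map_sum]
  have hcontent : ∀ (κ : V → ℕ) (i : ℕ),
      (∑ v, Finsupp.single (κ v) 1 : ℕ →₀ ℕ) i = Nat.card {v : V // κ v = i} := by
    intro κ i
    rw [Finsupp.finsetSum_apply, Nat.card_eq_fintype_card, Fintype.card_subtype,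
      Finset.card_filter]
    exact Finset.sum_congr rfl fun v _ ↦ by rw [Finsupp.single_apply]
  have hterm : ∀ κ : V → Fin N,
      coeff d (if IsProperColoring G κ then ∏ v, finVar N (κ v) else 0)
        = if IsProperColoring G κ ∧ ∀ i, Nat.card {v : V // (κ v : ℕ) = i} = d i
          then (1 : ℚ) else 0 := by
    intro κ
    have hd' : d = ∑ v, Finsupp.single (κ v : ℕ) 1
        ↔ ∀ i, Nat.card {v : V // (κ v : ℕ) = i} = d i := by
      rw [DFunLike.ext_iff]
      simp only [hcontent fun v ↦ (κ v : ℕ), eq_comm]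
    by_cases h : IsProperColoring G κ
    · rw [if_pos h, prod_finVar, coeff_monomial]
      simp only [hd', h, true_and]
    · rw [if_neg h, if_neg fun h' ↦ h h'.1, map_zero]
  simp only [hterm]
  rw [Finset.sum_boole]
  change (Nat.card {κ : G.Coloring ℕ // ∀ i, Nat.card {v : V // κ v = i} = d i} : ℚ) = _
  rw [← Fintype.card_subtype, ← Nat.card_eq_fintype_card]
  congr 1
  symm
  refine Nat.card_congr (Equiv.ofBijective (fun κ ↦ ⟨SimpleGraph.Coloring.mk
    (fun v ↦ (κ.1 v : ℕ)) fun {u v} huv h ↦ κ.2.1 u v huv (Fin.ext h), κ.2.2⟩) ⟨?_, ?_⟩)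
  · intro κ κ' h
    refine Subtype.ext (funext fun v ↦ Fin.ext ?_)
    exact DFunLike.congr_fun (Subtype.ext_iff.1 h) v
  · rintro ⟨κ, hκ⟩
    -- The exponent d vanishes from N on, so a coloring counted at d uses no color there and takes
    -- values in `Fin N`.
    have hlt : ∀ v, κ v < N := by
      intro v
      by_contra hge
      have h0 := (hκ (κ v)).trans (hd (κ v) (by omega))
      rw [Nat.card_eq_zero] at h0
      rcases h0 with h0 | h0
      · exact h0.elim ⟨v, rfl⟩
      · exact h0.not_finite inferInstance
    refine ⟨⟨fun v ↦ ⟨κ v, hlt v⟩, fun u v huv h ↦ ?_, hκ⟩, ?_⟩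
    · exact κ.valid huv (Fin.ext_iff.1 h)
    · rfl

theorem truncEq_elemSymmComp (N : ℕ) {n : ℕ} (I : Composition n) :
    TruncEq N (elemSymmComp I) (I.blocks.map (finEsymm (finVar N))).prod :=
  TruncEq.list_prod (truncEq_elemSymm N) I.blocks

end Truncation

/-! ### Positivity and the main theorem. -/

section Main

theorem listWeight_nonneg {L : List ℕ} (h : ∀ i ∈ L, 0 < i) : 0 ≤ listWeight L := by
  cases L with
  | nil => simp [listWeight]
  | cons a L =>
    refine mul_nonneg (Int.natCast_nonneg a) (List.prod_nonneg fun z hz ↦ ?_)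
    obtain ⟨b, hb, rfl⟩ := List.mem_map.1 hz
    have := h b (by simp [hb])
    omega

theorem compWeight_nonneg {n : ℕ} (I : Composition n) : 0 ≤ compWeight I :=
  listWeight_nonneg fun _ hi ↦ I.blocks_pos hi

theorem surplus_nonneg {n : ℕ} (I : Composition n) {a : ℕ} (ha : a ≤ n) : 0 ≤ surplus I a := by
  have := le_listSurplusSum (L := I.blocks) (a := a) (by rw [I.blocks_sum]; exact ha)
  rw [surplus, surplusSum_eq]
  omega

/-- With b the block after the partial sum l, the first factor is b - 2. If b = 1, then l ≥ 1 makes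
b a later block, and its factor b - 1 annihilates the weight. -/
theorem surplus_sub_one_mul_compWeight_nonneg {n l : ℕ} (hl : 1 ≤ l) (hn : l + 1 ≤ n)
    (I : Composition n) (h : surplus I l = 0) :
    0 ≤ (surplus I (l + 1) - 1) * compWeight I := by
  have hs := I.blocks_sum
  rw [surplus, surplusSum_eq] at h
  obtain ⟨J, K, hJK, hJ⟩ := exists_append_of_listSurplusSum_eq (L := I.blocks) (a := l)
    (by omega) (by omega)
  have hpos : ∀ i ∈ I.blocks, 0 < i := fun _ hi ↦ I.blocks_pos hi
  rw [compWeight, surplus, surplusSum_eq]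
  rw [hJK] at hs hpos ⊢
  cases K with
  | nil => simp at hs; omega
  | cons b K =>
    have hb : 0 < b := hpos b (by simp)
    subst hJ
    rw [listSurplusSum_append_cons J K hb]
    rcases Nat.eq_or_lt_of_le hb with hb1 | hb1
    · cases J with
      | nil => simp at hl
      | cons a J => simp [listWeight, ← hb1]
    · exact mul_nonneg (by push_cast; omega) (listWeight_nonneg hpos)

theorem mainTheorem7 (n l : ℕ) (hl : 1 ≤ l) (hn : l + 2 ≤ n) :
    chromaticSymm (multiLineGraph (tadpole (n - l) l)) =
        (∑ I : Composition n with surplus I l = 0,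
          (((surplus I (l + 1) - 1) * compWeight I : ℤ) : ℚ) • elemSymmComp I)
        + (2 : ℚ) • (∑ I : Composition n with 2 ≤ surplus I l,
            ((surplus I (l + 1) * compWeight I : ℤ) : ℚ) • elemSymmComp I)
      ∧ (∀ I : Composition n, surplus I l = 0 →
          0 ≤ (surplus I (l + 1) - 1) * compWeight I)
      ∧ (∀ I : Composition n, 2 ≤ surplus I l →
          0 ≤ surplus I (l + 1) * compWeight I) := by
  refine ⟨?_, surplus_sub_one_mul_compWeight_nonneg hl (by omega), fun I _ ↦
    mul_nonneg (surplus_nonneg I (by omega)) (compWeight_nonneg I)⟩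
  refine eq_of_forall_truncEq fun N ↦ ?_
  obtain ⟨m, hm⟩ : ∃ m, n - l = m + 2 := ⟨n - l - 2, by omega⟩
  obtain ⟨k, rfl⟩ : ∃ k, l = k + 1 := ⟨l - 1, by omega⟩
  obtain rfl : n = k + 1 + (m + 2) := by omega
  rw [hm]
  let _ : Fintype (tadpole (m + 2) (k + 1)).edgeSet := Fintype.ofFinite _
  refine (truncEq_chromaticSymm _ N).trans ?_
  rw [colorSum_lineGraph_tadpole, lineGraph_sum_eq (finVar N) (by omega) (by omega),
    Finset.sum_filter, Finset.sum_filter, ← sum_composition_blocks, ← sum_composition_blocks,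
    ← Finset.sum_filter, ← Finset.sum_filter]
  -- The expansion was proved over the coefficient ring R = `MvPowerSeries ℕ ℚ`, where integer
  -- coefficients are ring elements; they must become rational scalars.
  have hcoe : ∀ (z : ℤ) (f : MvPowerSeries ℕ ℚ), (z : MvPowerSeries ℕ ℚ) * f = (z : ℚ) • f := by
    intro z f
    rw [← zsmul_eq_mul, Int.cast_smul_eq_zsmul]
  refine TruncEq.add ?_ ?_
  · rw [Finset.filter_congr (q := fun I : Composition (k + 1 + (m + 2)) ↦
      surplus I (k + 1) = 0) fun I _ ↦ by rw [surplus, surplusSum_eq]; omega]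
    refine TruncEq.sum _ fun I _ ↦ ?_
    have h : ((listSurplusSum I.blocks (k + 1 + 1) : MvPowerSeries ℕ ℚ) - ((k + 1 : ℕ) + 1) - 1)
        * listTerm (finEsymm (finVar N)) I.blocks
        = (((surplus I (k + 1 + 1) - 1) * compWeight I : ℤ) : ℚ)
          • (I.blocks.map (finEsymm (finVar N))).prod := by
      rw [← hcoe, listTerm, surplus, surplusSum_eq, compWeight]
      push_cast
      ring
    rw [h]
    exact ((truncEq_elemSymmComp N I).smul _).symm
  · rw [Finset.filter_congr (q := fun I : Composition (k + 1 + (m + 2)) ↦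
      2 ≤ surplus I (k + 1)) fun I _ ↦ by rw [surplus, surplusSum_eq]; omega]
    have h2 : ∀ f : MvPowerSeries ℕ ℚ, 2 * f = (2 : ℚ) • f := fun f ↦ by
      exact_mod_cast hcoe 2 f
    rw [h2]
    refine (TruncEq.sum _ fun I _ ↦ ?_).smul 2
    have h : ((listSurplusSum I.blocks (k + 1 + 1) : MvPowerSeries ℕ ℚ) - ((k + 1 : ℕ) + 1))
        * listTerm (finEsymm (finVar N)) I.blocks
        = ((surplus I (k + 1 + 1) * compWeight I : ℤ) : ℚ)
          • (I.blocks.map (finEsymm (finVar N))).prod := by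
      rw [← hcoe, listTerm, surplus, surplusSum_eq, compWeight]
      push_cast
      ring
    rw [h]
    exact ((truncEq_elemSymmComp N I).smul _).symm

end Main

end
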